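/- Let $q$ be a prime power, and let $\mathrm{Tr}(x)=x+x^q$ and $\mathrm{Norm}(y)=y^{q+1}$ be the trace and norm functions from $\mathbb{F}_{q^2}$ to $\mathbb{F}_q$. Let $\mathcal{C}$ be the linear code over $\mathbb{F}_{q^2}$ generated by the rows of the matrix with $3$ rows whose columns are $(0,1,0)^{\top}$ and all $(1,x,y)^{\top}$ with $(x,y)\in\mathbb{F}_{q^2}^2$ and $\mathrm{Tr}(x)+\mathrm{Norm}(y)=0$, and let $\mathcal{C}^{\perp}=\{v : v\cdot c=0 \text{ for all } c\in\mathcal{C}\}$ be its dual code. A $t$-$(n,\kappa,\lambda)$ design is a set $\mathcal{P}$ of $n$ points with a set of $\kappa$-subsets of $\mathcal{P}$, called blocks, such that every $t$-subset of $\mathcal{P}$ is contained in exactly $\lambda$ blocks. The codewords of Hamming weight $\kappa$ in a code are said to hold a $t$-$(n,\kappa,\lambda)$ design, where $\lambda\geq 1$, if such codewords exist and the set of their supports (without repetition) is the set of blocks of a $t$-$(n,\kappa,\lambda)$ design on the set of coordinates. Then: (1) The codewords of Hamming weight $q^3-q$ in $\mathcal{C}$ hold a $2$-$(q^3+1,\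 q^3-q,\ (q-1)(q^3-q-1))$ design. (2) The complementary design of this design, whose blocks are the complements of its blocks, is a $2$-$(q^3+1,\ q+1,\ 1)$ design, i.e., a Steiner system $S(2,q+1,q^3+1)$. (3) The minimum weight of the nonzero codewords of $\mathcal{C}^{\perp}$ is $3$, and the codewords of weight $3$ in $\mathcal{C}^{\perp}$ hold a $2$-$(q^3+1,\ 3,\ \lambda)$ design with $$\lambda=\frac{6A_3^{\perp}}{q^3(q^2-1)(q^3+1)},$$ where $A_3^{\perp}$ denotes the number of codewords of weight $3$ in $\mathcal{C}^{\perp}$. -/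

import Mathlib

namespace DesignCodes

/-! ### Designs -/

/-- `(P, ℬ)` is a `t-(n, κ, lam)` design: `P` has `n` points, the blocks in `ℬ` are `κ`-subsets
of `P`, and every `t`-subset of `P` is contained in exactly `lam` blocks. The blocks form a set,
so that there are no repeated blocks. -/
structure IsDesign {P : Type*} [Fintype P] (ℬ : Set (Finset P)) (t n κ lam : ℕ) : Prop where
  card_points : Fintype.card P = n
  one_le_block : 1 ≤ κ
  block_le : κ ≤ n
  one_le_t : 1 ≤ t
  t_le : t ≤ κ
  card_block : ∀ B ∈ ℬ, B.card = κ
  balanced : ∀ T : Finset P, T.card = t → {B | B ∈ ℬ ∧ T ⊆ B}.ncard = lam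

/-- `(P, ℬ)` is a Steiner system `S(t, κ, n)`: a `t-(n, κ, 1)` design with `t ≥ 2`. -/
def IsSteinerSystem {P : Type*} [Fintype P] (ℬ : Set (Finset P)) (t κ n : ℕ) : Prop :=
  2 ≤ t ∧ IsDesign ℬ t n κ 1

/-- The blocks of the complementary design: the complements of the blocks in `ℬ`. -/
def complementBlocks {P : Type*} [Fintype P] [DecidableEq P] (ℬ : Set (Finset P)) :
    Set (Finset P) :=
  {B | ∃ B₀ ∈ ℬ, B = B₀ᶜ}

/-! ### Linear codes: subspaces of `ι → F`, with coordinates indexed by a finite type `ι` -/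

section Codes

variable {F ι : Type*} [Field F] [DecidableEq F] [Fintype ι]

/-- The support of a word. -/
def supp (c : ι → F) : Finset ι := {i | c i ≠ 0}

/-- The set of the supports of all codewords of Hamming weight `κ` in `C`. -/
def blocks (C : Submodule F (ι → F)) (κ : ℕ) : Set (Finset ι) :=
  {B | ∃ c ∈ C, hammingNorm c = κ ∧ B = supp c}

/-- The number of codewords of Hamming weight `κ` in `C`. -/
noncomputable def numWeight (C : Submodule F (ι → F)) (κ : ℕ) : ℕ :=
  {c | c ∈ C ∧ hammingNorm c = κ}.ncard

/-- The codewords of weight `κ` in `C` hold a `t-(n, κ, lam)` design: there are such codewords,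
`lam` is positive, and their supports form the blocks of such a design on the coordinates. -/
def HoldsDesign (C : Submodule F (ι → F)) (t n κ lam : ℕ) : Prop :=
  numWeight C κ ≠ 0 ∧ 0 < lam ∧ IsDesign (blocks C κ) t n κ lam

/-- `d` is the minimum weight of the nonzero codewords of `C`. -/
def IsMinWeight (C : Submodule F (ι → F)) (d : ℕ) : Prop :=
  IsLeast {w | ∃ c ∈ C, c ≠ 0 ∧ hammingNorm c = w} d

end Codes

/-- The (Euclidean) dual code. -/
def dualCode {F ι : Type*} [Field F] [Fintype ι] (C : Submodule F (ι → F)) :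
    Submodule F (ι → F) where
  carrier := {v | ∀ c ∈ C, v ⬝ᵥ c = 0}
  add_mem' := by
    intro a b ha hb c hc
    rw [add_dotProduct, ha c hc, hb c hc, add_zero]
  zero_mem' := by
    intro c _
    exact zero_dotProduct c
  smul_mem' := by
    intro r a ha c hc
    rw [smul_dotProduct, ha c hc, smul_zero]

/-! ### The code `C_{f,g}` -/

/-- The set of pairs `(x, y)` with `f x + g y = 0`, as a type. -/
abbrev ZeroPairs {L A : Type*} [AddMonoid A] (f g : L → A) : Type _ :=
  {p : L × L // f p.1 + g p.2 = 0}

/-- The matrix with first column `(0, 1, 0)` (at the index `none`), followed by the columns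
`(1, x, y)` for all `(x, y)` with `f x + g y = 0`. -/
def genMatrix {L A : Type*} [Field L] [AddMonoid A] (f g : L → A) :
    Matrix (Fin 3) (Option (ZeroPairs f g)) L :=
  Matrix.of fun i j =>
    match j with
    | none => ![0, 1, 0] i
    | some p => ![1, p.1.1, p.1.2] i

/-- The code `C_{f,g}`, generated by the rows of the matrix `genMatrix f g`. -/
def code {L A : Type*} [Field L] [AddMonoid A] (f g : L → A) :
    Submodule L (Option (ZeroPairs f g) → L) :=
  Submodule.span L (Set.range (genMatrix f g).row)

/-- The code `C_{f,g}` for `f` the trace and `g` the norm of `L` over `K`. -/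
noncomputable def traceNormCode (K L : Type*) [Field K] [Field L] [Algebra K L] :
    Submodule L
      (Option (ZeroPairs (fun x : L => Algebra.trace K L x) (fun y : L => Algebra.norm K y)) → L) :=
  code (fun x : L => Algebra.trace K L x) (fun y : L => Algebra.norm K y)

end DesignCodes

namespace DesignCodes

namespace IsDesign

variable {P : Type*} [Fintype P] {ℬ : Set (Finset P)} {n κ lam : ℕ}

theorem ncard_mem_mul (h : IsDesign ℬ 2 n κ lam) (p : P) :
    {B | B ∈ ℬ ∧ p ∈ B}.ncard * (κ - 1) = lam * (n - 1) := by
  classical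
  have key := Finset.card_mul_eq_card_mul (s := Finset.univ.erase p)
    (t := Finset.univ.filter fun B => B ∈ ℬ ∧ p ∈ B) (fun x B => x ∈ B) (m := lam) (n := κ - 1)
    (by
      intro x hx
      rw [← h.balanced {p, x} (Finset.card_pair (Finset.ne_of_mem_erase hx).symm),
        Set.ncard_eq_toFinset_card']
      congr 1
      ext B
      simp [Finset.bipartiteAbove, Finset.insert_subset_iff]
      tauto)
    (by
      intro B hB
      simp only [Finset.mem_filter, Finset.mem_univ, true_and] at hB
      rw [← h.card_block B hB.1, ← Finset.card_erase_of_mem hB.2]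
      congr 1
      ext x
      simp [Finset.bipartiteBelow])
  rw [Finset.card_erase_of_mem (Finset.mem_univ p), Finset.card_univ, h.card_points] at key
  rw [Set.ncard_eq_toFinset_card', mul_comm lam, key]
  congr 2
  ext B
  simp

theorem ncard_mul {r : ℕ} (h : IsDesign ℬ 2 n κ lam)
    (hr : ∀ p, {B | B ∈ ℬ ∧ p ∈ B}.ncard = r) : ℬ.ncard * κ = n * r := by
  classical
  have key := Finset.card_mul_eq_card_mul (s := (Finset.univ : Finset P))
    (t := Finset.univ.filter fun B => B ∈ ℬ) (fun x B => x ∈ B) (m := r) (n := κ)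
    (by
      intro x _
      rw [← hr x, Set.ncard_eq_toFinset_card']
      congr 1
      ext B
      simp [Finset.bipartiteAbove])
    (by
      intro B hB
      simp only [Finset.mem_filter, Finset.mem_univ, true_and] at hB
      rw [← h.card_block B hB]
      congr 1
      ext x
      simp [Finset.bipartiteBelow])
  rw [Finset.card_univ, h.card_points] at key
  rw [Set.ncard_eq_toFinset_card', key]
  congr 2
  ext B
  simp

theorem ncard_complementBlocks [DecidableEq P] {r : ℕ} (h : IsDesign ℬ 2 n κ lam)
    (hr : ∀ p, {B | B ∈ ℬ ∧ p ∈ B}.ncard = r) (T : Finset P) (hT : T.card = 2) :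
    {B | B ∈ complementBlocks ℬ ∧ T ⊆ B}.ncard + 2 * r = ℬ.ncard + lam := by
  obtain ⟨p, x, hpx, rfl⟩ := Finset.card_eq_two.1 hT
  have e1 : {B | B ∈ complementBlocks ℬ ∧ {p, x} ⊆ B} =
      compl '' (ℬ \ ({B | B ∈ ℬ ∧ p ∈ B} ∪ {B | B ∈ ℬ ∧ x ∈ B})) := by
    ext B
    simp only [complementBlocks, Set.mem_ofPred_eq, Set.mem_image, Set.mem_sdiff, Set.mem_union,
      Finset.insert_subset_iff, Finset.singleton_subset_iff]
    constructor
    · rintro ⟨⟨B₀, h0, rfl⟩, h1⟩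
      simp only [Finset.mem_compl] at h1
      exact ⟨B₀, ⟨h0, by tauto⟩, rfl⟩
    · rintro ⟨B₀, ⟨h0, h1⟩, rfl⟩
      simp only [Finset.mem_compl]
      exact ⟨⟨B₀, h0, rfl⟩, by tauto⟩
  have e2 := Set.ncard_union_add_ncard_inter {B | B ∈ ℬ ∧ p ∈ B} {B | B ∈ ℬ ∧ x ∈ B}
  have e3 : {B | B ∈ ℬ ∧ p ∈ B} ∩ {B | B ∈ ℬ ∧ x ∈ B} = {B | B ∈ ℬ ∧ {p, x} ⊆ B} := by
    ext B
    simp only [Set.mem_inter_iff, Set.mem_ofPred_eq, Finset.insert_subset_iff,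
      Finset.singleton_subset_iff]
    tauto
  have e4 := Set.ncard_sdiff_add_ncard_of_subset
    (s := {B | B ∈ ℬ ∧ p ∈ B} ∪ {B | B ∈ ℬ ∧ x ∈ B}) (t := ℬ) (by
      rintro B (hB | hB) <;> exact hB.1)
  rw [e3, h.balanced _ hT, hr, hr] at e2
  rw [e1, Set.ncard_image_of_injective _ compl_injective]
  omega

end IsDesign

/-! ### Point sets in the projective plane that every line meets in `1` or `k` points -/

section Steiner

open Matrix

variable {F ι : Type*} [Field F] [DecidableEq F] [Fintype ι]

/-- The coordinates at which the codeword with coefficient vector `u` vanishes. -/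
def zeroSet (G : Matrix (Fin 3) ι F) (u : Fin 3 → F) : Finset ι := {p | (u ᵥ* G) p = 0}

/-- The zero sets of size `k` of the codewords with nonzero coefficient vector. -/
def lines (G : Matrix (Fin 3) ι F) (k : ℕ) : Set (Finset ι) :=
  {B | ∃ u ≠ 0, B = zeroSet G u ∧ B.card = k}

theorem mem_zeroSet {G : Matrix (Fin 3) ι F} {u : Fin 3 → F} {p : ι} :
    p ∈ zeroSet G u ↔ u ⬝ᵥ Gᵀ p = 0 :=
  Finset.mem_filter_univ p

theorem eq_smul_of_crossProduct_eq_zero {F : Type*} [Field F] {u v : Fin 3 → F} (hu : u ≠ 0)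
    (h : crossProduct u v = 0) : ∃ t : F, v = t • u := by
  by_contra! hv
  exact (crossProduct_ne_zero_iff_linearIndependent.2
    ((LinearIndependent.pair_iff' hu).2 fun t ht => hv t ht.symm)) h

theorem hammingNorm_vecMul_add (G : Matrix (Fin 3) ι F) (u : Fin 3 → F) :
    hammingNorm (u ᵥ* G) + (zeroSet G u).card = Fintype.card ι := by
  rw [← Finset.card_univ, add_comm]
  exact Finset.card_filter_add_card_filter_not (s := Finset.univ) (fun p => (u ᵥ* G) p = 0)

theorem supp_eq_compl [DecidableEq ι] (G : Matrix (Fin 3) ι F) (u : Fin 3 → F) :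
    supp (u ᵥ* G) = (zeroSet G u)ᶜ := by
  ext p; simp [supp, zeroSet]

omit [DecidableEq F] [Fintype ι] in
theorem mem_span_row {G : Matrix (Fin 3) ι F} {c : ι → F} :
    c ∈ Submodule.span F (Set.range G.row) ↔ ∃ u, u ᵥ* G = c := by
  rw [← range_vecMulLinear]; simp

omit [DecidableEq F] in
theorem mem_dualCode_span_row {G : Matrix (Fin 3) ι F} {v : ι → F} :
    v ∈ dualCode (Submodule.span F (Set.range G.row)) ↔ G *ᵥ v = 0 := by
  constructor
  · intro h
    ext i
    have := h (G.row i) (Submodule.subset_span ⟨i, rfl⟩)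
    rw [dotProduct_comm] at this
    exact this
  · intro h c hc
    obtain ⟨u, rfl⟩ := mem_span_row.1 hc
    rw [dotProduct_comm, ← dotProduct_mulVec, h, dotProduct_zero]

theorem blocks_eq_complementBlocks [DecidableEq ι] (G : Matrix (Fin 3) ι F) {w k : ℕ} (hw : w ≠ 0)
    (h : w + k = Fintype.card ι) :
    blocks (Submodule.span F (Set.range G.row)) w = complementBlocks (lines G k) := by
  ext B
  constructor
  · rintro ⟨c, hc, hcw, rfl⟩
    obtain ⟨u, rfl⟩ := mem_span_row.1 hc
    refine ⟨_, ⟨u, ?_, rfl, ?_⟩, supp_eq_compl G u⟩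
    · rintro rfl
      simp at hcw
      omega
    · have := hammingNorm_vecMul_add G u
      omega
  · rintro ⟨_, ⟨u, -, rfl, hk⟩, rfl⟩
    refine ⟨u ᵥ* G, mem_span_row.2 ⟨u, rfl⟩, ?_, (supp_eq_compl G u).symm⟩
    have := hammingNorm_vecMul_add G u
    omega

theorem complementBlocks_complementBlocks [DecidableEq ι] (ℬ : Set (Finset ι)) :
    complementBlocks (complementBlocks ℬ) = ℬ := by
  ext B
  constructor
  · rintro ⟨_, ⟨B, hB, rfl⟩, rfl⟩
    rwa [compl_compl]
  · intro hB
    exact ⟨Bᶜ, ⟨B, hB, rfl⟩, (compl_compl B).symm⟩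

/-- Two points lie on exactly one line. -/
theorem existsUnique_line {G : Matrix (Fin 3) ι F} {k : ℕ}
    (hG : Pairwise fun p p' => crossProduct (Gᵀ p) (Gᵀ p') ≠ 0)
    (hk : ∀ u, u ≠ 0 → (zeroSet G u).card = 1 ∨ (zeroSet G u).card = k)
    {p p' : ι} (hp : p ≠ p') : ∃! B, B ∈ lines G k ∧ p ∈ B ∧ p' ∈ B := by
  classical
  set u := crossProduct (Gᵀ p) (Gᵀ p') with hu
  have h1 : p ∈ zeroSet G u := by
    rw [mem_zeroSet, dotProduct_comm, hu, dot_self_cross]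
  have h2 : p' ∈ zeroSet G u := by
    rw [mem_zeroSet, dotProduct_comm, hu, dot_cross_self]
  refine ⟨zeroSet G u, ⟨⟨u, hG hp, rfl, (hk u (hG hp)).resolve_left fun h => ?_⟩, h1, h2⟩, ?_⟩
  · exact hp (Finset.card_le_one.1 h.le _ h1 _ h2)
  · rintro _ ⟨⟨v, hv, rfl, -⟩, h3, h4⟩
    rw [mem_zeroSet] at h3 h4
    have : crossProduct u v = 0 := by
      rw [hu, cross_cross_eq_smul_sub_smul, dotProduct_comm, h3, dotProduct_comm, h4]
      simp
    obtain ⟨t, rfl⟩ := eq_smul_of_crossProduct_eq_zero (hG hp) this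
    have ht : t ≠ 0 := by rintro rfl; simp at hv
    ext x
    simp only [mem_zeroSet, smul_dotProduct, smul_eq_mul, mul_eq_zero, ht, false_or, hu]

theorem isDesign_lines {G : Matrix (Fin 3) ι F} {k : ℕ} (h2 : 2 ≤ k) (hn : k ≤ Fintype.card ι)
    (hG : Pairwise fun p p' => crossProduct (Gᵀ p) (Gᵀ p') ≠ 0)
    (hk : ∀ u, u ≠ 0 → (zeroSet G u).card = 1 ∨ (zeroSet G u).card = k) :
    IsDesign (lines G k) 2 (Fintype.card ι) k 1 where
  card_points := rfl
  one_le_block := by omega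
  block_le := hn
  one_le_t := by omega
  t_le := h2
  card_block := by
    rintro B ⟨-, -, -, h⟩
    exact h
  balanced := by
    classical
    intro T hT
    obtain ⟨p, x, hpx, rfl⟩ := Finset.card_eq_two.1 hT
    obtain ⟨B, hB, hB'⟩ := existsUnique_line hG hk hpx
    rw [Set.ncard_eq_one]
    refine ⟨B, ?_⟩
    ext B'
    simp only [Finset.insert_subset_iff, Finset.singleton_subset_iff, Set.mem_ofPred_eq,
      Set.mem_singleton_iff]
    exact ⟨fun h => hB' B' h, fun h => h ▸ hB⟩

/-! ### Codewords of weight three in the dual code -/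

omit [DecidableEq F] [Fintype ι] in
theorem linearIndependent_col {G : Matrix (Fin 3) ι F}
    (hG : Pairwise fun p p' => crossProduct (Gᵀ p) (Gᵀ p') ≠ 0) {p p' : ι} (hp : p ≠ p')
    {s t : F} (h : s • Gᵀ p + t • Gᵀ p' = 0) : s = 0 ∧ t = 0 := by
  have h0 : crossProduct (Gᵀ p) (Gᵀ p') ≠ 0 := hG hp
  have h1 := crossProduct_ne_zero_iff_linearIndependent.1 h0
  rw [LinearIndependent.pair_iff] at h1
  exact h1 s t h

theorem mulVec_eq_sum_of_supp_subset {G : Matrix (Fin 3) ι F} {v : ι → F} {T : Finset ι}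
    (h : supp v ⊆ T) : G *ᵥ v = ∑ p ∈ T, v p • Gᵀ p := by
  ext i
  simp only [mulVec, dotProduct, Finset.sum_apply, Pi.smul_apply, smul_eq_mul, transpose_apply]
  rw [← Finset.sum_subset (Finset.subset_univ T)]
  · exact Finset.sum_congr rfl fun p _ => mul_comm _ _
  · intro p _ hp
    have : v p = 0 := by
      by_contra h0
      exact hp (h (by simpa [supp] using h0))
    rw [this, mul_zero]

theorem eq_zero_of_mulVec_eq_zero {G : Matrix (Fin 3) ι F}
    (hG : Pairwise fun p p' => crossProduct (Gᵀ p) (Gᵀ p') ≠ 0) {p p' : ι} (hp : p ≠ p')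
    {v : ι → F} (hv : G *ᵥ v = 0) (h : ∀ x, x ≠ p → x ≠ p' → v x = 0) : v = 0 := by
  classical
  have hs : supp v ⊆ {p, p'} := by
    intro x hx
    simp only [supp, Finset.mem_filter, Finset.mem_univ, true_and] at hx
    by_contra hc
    simp only [Finset.mem_insert, Finset.mem_singleton, not_or] at hc
    exact hx (h x hc.1 hc.2)
  rw [mulVec_eq_sum_of_supp_subset hs, Finset.sum_pair hp] at hv
  obtain ⟨h1, h2⟩ := linearIndependent_col hG hp hv
  ext x
  by_cases hx : x = p
  · rw [hx, h1]; rfl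
  by_cases hx' : x = p'
  · rw [hx', h2]; rfl
  exact h x hx hx'

theorem three_le_hammingNorm [Nontrivial ι] {G : Matrix (Fin 3) ι F}
    (hG : Pairwise fun p p' => crossProduct (Gᵀ p) (Gᵀ p') ≠ 0) {v : ι → F}
    (hv : G *ᵥ v = 0) (h0 : v ≠ 0) : 3 ≤ hammingNorm v := by
  classical
  by_contra! hlt
  obtain ⟨T, hsT, hT⟩ : ∃ T, supp v ⊆ T ∧ T.card = 2 :=
    Finset.exists_superset_card_eq (show (supp v).card ≤ 2 from Nat.le_of_lt_succ hlt)
      (Fintype.one_lt_card_iff_nontrivial.2 inferInstance)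
  obtain ⟨p, x, hpx, rfl⟩ := Finset.card_eq_two.1 hT
  refine h0 (eq_zero_of_mulVec_eq_zero hG hpx hv fun y h1 h2 => ?_)
  by_contra hc
  have := hsT (show y ∈ supp v by simpa [supp] using hc)
  simp [h1, h2] at this

theorem blocks_dualCode_three [Nontrivial ι] {G : Matrix (Fin 3) ι F} {k : ℕ}
    (hG : Pairwise fun p p' => crossProduct (Gᵀ p) (Gᵀ p') ≠ 0)
    (hk : ∀ u, u ≠ 0 → (zeroSet G u).card = 1 ∨ (zeroSet G u).card = k) :
    blocks (dualCode (Submodule.span F (Set.range G.row))) 3 =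
      {T | T.card = 3 ∧ ∃ B ∈ lines G k, T ⊆ B} := by
  classical
  ext T
  constructor
  · rintro ⟨v, hv, h3, rfl⟩
    rw [mem_dualCode_span_row] at hv
    have h3' : (supp v).card = 3 := h3
    refine ⟨h3', ?_⟩
    obtain ⟨x, y, z, hxy, hxz, hyz, hs⟩ := Finset.card_eq_three.1 h3'
    obtain ⟨B, ⟨hB, hx, hy⟩, -⟩ := existsUnique_line hG hk hxy
    refine ⟨B, hB, ?_⟩
    obtain ⟨u, -, rfl, -⟩ := hB
    rw [hs]
    simp only [Finset.insert_subset_iff, Finset.singleton_subset_iff]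
    refine ⟨hx, hy, ?_⟩
    rw [mem_zeroSet] at hx hy ⊢
    have hz : v z ≠ 0 := by
      have : z ∈ supp v := by rw [hs]; simp
      simpa [supp] using this
    have := congrArg (fun w => u ⬝ᵥ w) (hv.symm.trans (mulVec_eq_sum_of_supp_subset hs.subset))
    rw [Finset.sum_insert (by simp [hxy, hxz]), Finset.sum_pair hyz] at this
    simpa [dotProduct_add, dotProduct_smul, hx, hy, hz] using this
  · rintro ⟨h3, B, ⟨u, hu, rfl, -⟩, hT⟩
    obtain ⟨e⟩ : Nonempty (Fin 3 ≃ T) := ⟨(Fintype.equivFinOfCardEq (by simpa using h3)).symm⟩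
    have hdet : (G.submatrix id fun i => (e i : ι)).det = 0 := by
      rw [← exists_vecMul_eq_zero_iff]
      refine ⟨u, hu, ?_⟩
      ext i
      exact mem_zeroSet.1 (hT (e i).2)
    obtain ⟨w, hw, hw0⟩ := exists_mulVec_eq_zero_iff.2 hdet
    set v : ι → F := fun p => if h : p ∈ T then w (e.symm ⟨p, h⟩) else 0 with hv
    have hve : ∀ i, v (e i) = w i := fun i => by simp [hv]
    have hsT : supp v ⊆ T := by
      intro p hp
      by_contra h
      simp [supp, hv, h] at hp
    have hv0 : G *ᵥ v = 0 := by
      rw [mulVec_eq_sum_of_supp_subset hsT, ← Finset.sum_coe_sort, ← e.sum_comp, ← hw0]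
      ext i
      simp only [hve, Finset.sum_apply, Pi.smul_apply, smul_eq_mul, transpose_apply, mulVec,
        dotProduct, submatrix_apply, id]
      exact Finset.sum_congr rfl fun p _ => mul_comm _ _
    have hne : v ≠ 0 := by
      intro h
      refine hw (funext fun i => ?_)
      rw [← hve, h]; rfl
    have hle := three_le_hammingNorm hG hv0 hne
    have heq : supp v = T := Finset.eq_of_subset_of_card_le hsT (h3.trans_le hle)
    exact ⟨v, mem_dualCode_span_row.2 hv0, (congrArg Finset.card heq).trans h3, heq.symm⟩

theorem isDesign_blocks_dualCode_three [Nontrivial ι] {G : Matrix (Fin 3) ι F} {k : ℕ}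
    (hn : 3 ≤ Fintype.card ι)
    (hG : Pairwise fun p p' => crossProduct (Gᵀ p) (Gᵀ p') ≠ 0)
    (hk : ∀ u, u ≠ 0 → (zeroSet G u).card = 1 ∨ (zeroSet G u).card = k) :
    IsDesign (blocks (dualCode (Submodule.span F (Set.range G.row))) 3) 2 (Fintype.card ι) 3
      (k - 2) where
  card_points := rfl
  one_le_block := by omega
  block_le := hn
  one_le_t := by omega
  t_le := by omega
  card_block := by
    rintro B ⟨v, -, h, rfl⟩
    exact h
  balanced := by
    classical
    intro T hT
    obtain ⟨p, x, hpx, rfl⟩ := Finset.card_eq_two.1 hT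
    obtain ⟨B, ⟨hB, hpB, hxB⟩, huniq⟩ := existsUnique_line hG hk hpx
    have hsub : {p, x} ⊆ B := by simp [Finset.insert_subset_iff, hpB, hxB]
    have hBk : B.card = k := by
      obtain ⟨-, -, -, h⟩ := hB
      exact h
    have himg : {S | S ∈ blocks (dualCode (Submodule.span F (Set.range G.row))) 3 ∧ {p, x} ⊆ S} =
        ((B \ {p, x}).image fun z => insert z {p, x} : Finset (Finset ι)) := by
      rw [blocks_dualCode_three hG hk]
      ext S
      simp only [Set.mem_ofPred_eq, Finset.coe_image, Set.mem_image, Finset.mem_coe,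
        Finset.mem_sdiff]
      constructor
      · rintro ⟨⟨hS, B', hB', hSB'⟩, hpS⟩
        obtain ⟨z, hz⟩ := Finset.card_eq_one.1
          (show (S \ {p, x}).card = 1 by rw [Finset.card_sdiff_of_subset hpS, hS, hT])
        have hzS : z ∈ S \ {p, x} := by simp [hz]
        rw [Finset.mem_sdiff] at hzS
        have hBB' : B' = B :=
          huniq B' ⟨hB', hSB' (hpS (by simp)), hSB' (hpS (by simp))⟩
        refine ⟨z, ⟨hBB' ▸ hSB' hzS.1, hzS.2⟩, ?_⟩
        rw [Finset.insert_eq, ← hz, Finset.sdiff_union_of_subset hpS]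
      · rintro ⟨z, ⟨hzB, hz⟩, rfl⟩
        refine ⟨⟨?_, B, hB, Finset.insert_subset hzB hsub⟩, Finset.subset_insert _ _⟩
        rw [Finset.card_insert_of_notMem hz, hT]
    rw [himg, Set.ncard_coe_finset, Finset.card_image_of_injOn, Finset.card_sdiff_of_subset hsub,
      hBk, hT]
    intro z hz z' hz' hzz
    have hz : z ∉ ({p, x} : Finset ι) := (Finset.mem_sdiff.1 hz).2
    have : z ∈ insert z' ({p, x} : Finset ι) :=
      (Finset.ext_iff.1 hzz z).1 (Finset.mem_insert_self z _)
    exact (Finset.mem_insert.1 this).resolve_right hz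

theorem supp_smul {t : F} (ht : t ≠ 0) (v : ι → F) : supp (t • v) = supp v := by
  ext p; simp [supp, ht]

theorem numWeight_dualCode_three [Fintype F] [Nontrivial ι] {G : Matrix (Fin 3) ι F}
    (hG : Pairwise fun p p' => crossProduct (Gᵀ p) (Gᵀ p') ≠ 0) :
    numWeight (dualCode (Submodule.span F (Set.range G.row))) 3 =
      (blocks (dualCode (Submodule.span F (Set.range G.row))) 3).ncard * (Fintype.card F - 1) := by
  classical
  set D := dualCode (Submodule.span F (Set.range G.row)) with hD
  rw [numWeight, Set.ncard_eq_toFinset_card', Set.ncard_eq_toFinset_card',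
    Finset.card_eq_sum_card_fiberwise (f := supp) (t := (blocks D 3).toFinset)]
  · refine Finset.sum_const_nat fun T hT => ?_
    rw [Set.mem_toFinset] at hT
    obtain ⟨v, hv, h3, rfl⟩ := hT
    obtain ⟨x, y, z, hxy, hxz, hyz, hs⟩ := Finset.card_eq_three.1 (show (supp v).card = 3 from h3)
    have hvx : v x ≠ 0 := by
      have : x ∈ supp v := by rw [hs]; simp
      simpa [supp] using this
    have : ({c ∈ {c | c ∈ D ∧ hammingNorm c = 3}.toFinset | supp c = supp v} : Finset _) =
        (Finset.univ.erase (0 : F)).image fun t => t • v := by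
      ext c
      simp only [Finset.mem_filter, Set.mem_toFinset, Set.mem_ofPred_eq, Finset.mem_image,
        Finset.mem_erase, Finset.mem_univ, and_true]
      constructor
      · rintro ⟨⟨hc, -⟩, hcs⟩
        have hcx : c x ≠ 0 := by
          have : x ∈ supp c := by rw [hcs, hs]; simp
          simpa [supp] using this
        refine ⟨c x / v x, div_ne_zero hcx hvx, ?_⟩
        rw [← sub_eq_zero]
        refine eq_zero_of_mulVec_eq_zero hG hyz
          (mem_dualCode_span_row.1 (D.sub_mem (D.smul_mem _ hv) hc)) fun a hay haz => ?_
        by_cases hax : a = x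
        · subst hax
          simp [hvx]
        · have ha : a ∉ supp v := by simp [hs, hax, hay, haz]
          have ha' : a ∉ supp c := hcs ▸ ha
          simp only [supp, Finset.mem_filter, Finset.mem_univ, true_and, not_not] at ha ha'
          simp [ha, ha']
      · rintro ⟨t, ht, rfl⟩
        exact ⟨⟨D.smul_mem t hv, (congrArg Finset.card (supp_smul ht v)).trans h3⟩,
          supp_smul ht v⟩
    rw [this, Finset.card_image_of_injective, Finset.card_erase_of_mem (Finset.mem_univ _),
      Finset.card_univ]
    intro s t hst
    have := congrFun hst x
    simpa [hvx] using this
  · intro c hc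
    simp only [Set.coe_toFinset, Set.mem_ofPred_eq] at hc ⊢
    exact ⟨c, hc.1, hc.2, rfl⟩

end Steiner


/-! ### Fibres of the trace and the norm -/

@[to_additive]
theorem card_fiber_mul_card {A B : Type*} [Group A] [Fintype A] [Group B] [Fintype B]
    [DecidableEq B] (f : A →* B) (hf : Function.Surjective f) (b : B) :
    (Finset.univ.filter fun a => f a = b).card * Fintype.card B = Fintype.card A := by
  have h := Finset.card_eq_sum_card_fiberwise (f := f) (s := Finset.univ) (t := Finset.univ)
    (fun _ _ => Finset.mem_coe.2 (Finset.mem_univ _))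
  rw [Finset.sum_const_nat fun b' _ => MonoidHom.card_fiber_eq_of_mem_range f (hf b') (hf b),
    Finset.card_univ, Finset.card_univ] at h
  rw [h, Nat.mul_comm]

section TraceNorm

variable {K L : Type*} [Field K] [Fintype K] [DecidableEq K] [Field L] [Fintype L] [DecidableEq L]
  [Algebra K L]

omit [DecidableEq K] [DecidableEq L] in
theorem card_eq_sq (hKL : Module.finrank K L = 2) : Fintype.card L = Fintype.card K ^ 2 := by
  rw [Module.card_eq_pow_finrank (K := K), hKL]

omit [DecidableEq L] in
theorem card_trace_eq (hKL : Module.finrank K L = 2) (k : K) :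
    (Finset.univ.filter fun x : L => Algebra.trace K L x = k).card = Fintype.card K := by
  have h := card_fiber_add_card (Algebra.trace K L).toAddMonoidHom
    (Algebra.trace_surjective K L) k
  rw [card_eq_sq hKL, sq] at h
  exact Nat.eq_of_mul_eq_mul_right Fintype.card_pos h

theorem card_norm_eq (hKL : Module.finrank K L = 2) {k : K} (hk : k ≠ 0) :
    (Finset.univ.filter fun x : L => Algebra.norm K x = k).card = Fintype.card K + 1 := by
  have h := card_fiber_mul_card (Units.map (Algebra.norm K (S := L)))
    (FiniteField.unitsMap_norm_surjective K L) (Units.mk0 k hk)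
  rw [Fintype.card_units, Fintype.card_units, card_eq_sq hKL] at h
  have hq : 1 < Fintype.card K := Fintype.one_lt_card
  have h' : Fintype.card K ^ 2 - 1 = (Fintype.card K + 1) * (Fintype.card K - 1) := by
    rw [← Nat.sq_sub_sq, one_pow]
  rw [h'] at h
  rw [← Nat.eq_of_mul_eq_mul_right (by omega) h]
  symm
  refine Finset.card_nbij (fun z : Lˣ => (z : L)) ?_ ?_ ?_
  · intro z hz
    simpa [Units.ext_iff] using hz
  · exact fun _ _ _ _ h => Units.ext h
  · intro x hx
    have hx : Algebra.norm K x = k := by simpa using hx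
    have hx0 : x ≠ 0 := by
      rintro rfl
      have : FiniteDimensional K L := Module.Finite.of_finite
      exact hk (hx.symm.trans Algebra.norm_zero)
    exact ⟨Units.mk0 x hx0, by simpa [Units.ext_iff] using hx, rfl⟩

omit [DecidableEq K] [DecidableEq L] in
theorem algebraMap_trace_eq (hKL : Module.finrank K L = 2) (x : L) :
    algebraMap K L (Algebra.trace K L x) = x + FiniteField.frobeniusAlgHom K L x := by
  rw [FiniteField.algebraMap_trace_eq_sum_pow, hKL, Finset.sum_range_succ, Finset.sum_range_one]
  simp

omit [DecidableEq K] [DecidableEq L] in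
theorem algebraMap_norm_eq (hKL : Module.finrank K L = 2) (x : L) :
    algebraMap K L (Algebra.norm K x) = x * FiniteField.frobeniusAlgHom K L x := by
  rw [FiniteField.algebraMap_norm_eq_prod_pow, hKL, Finset.prod_range_succ, Finset.prod_range_one]
  simp

omit [DecidableEq K] [DecidableEq L] in
theorem frobeniusAlgHom_frobeniusAlgHom (hKL : Module.finrank K L = 2) (x : L) :
    FiniteField.frobeniusAlgHom K L (FiniteField.frobeniusAlgHom K L x) = x := by
  simp only [FiniteField.coe_frobeniusAlgHom]
  rw [← pow_mul, ← sq, ← card_eq_sq hKL, FiniteField.pow_card]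

omit [DecidableEq K] [DecidableEq L] in
theorem norm_add_frobeniusAlgHom (hKL : Module.finrank K L = 2) (y β : L) :
    Algebra.norm K (y + FiniteField.frobeniusAlgHom K L β) =
      Algebra.norm K y + Algebra.trace K L (β * y) + Algebra.norm K β := by
  apply (algebraMap K L).injective
  simp only [map_add, algebraMap_norm_eq hKL, algebraMap_trace_eq hKL,
    frobeniusAlgHom_frobeniusAlgHom hKL, map_mul]
  ring

theorem card_trace_add_norm_eq_zero (hKL : Module.finrank K L = 2) (α β : L) :
    (Finset.univ.filter fun y : L =>
        Algebra.trace K L (α + β * y) + Algebra.norm K y = 0).card = 1 ∨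
      (Finset.univ.filter fun y : L =>
        Algebra.trace K L (α + β * y) + Algebra.norm K y = 0).card = Fintype.card K + 1 := by
  have h : (Finset.univ.filter fun y : L =>
        Algebra.trace K L (α + β * y) + Algebra.norm K y = 0).card =
      (Finset.univ.filter fun z : L =>
        Algebra.norm K z = Algebra.norm K β - Algebra.trace K L α).card := by
    refine Finset.card_equiv (Equiv.addRight (FiniteField.frobeniusAlgHom K L β)) fun y => ?_
    rw [Finset.mem_filter_univ, Finset.mem_filter_univ, Equiv.coe_addRight,
      norm_add_frobeniusAlgHom hKL, map_add]
    constructor <;> intro h <;> linear_combination h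
  rw [h]
  by_cases h0 : Algebra.norm K β - Algebra.trace K L α = 0
  · left
    have : FiniteDimensional K L := Module.Finite.of_finite
    rw [h0, Finset.card_eq_one]
    exact ⟨0, by ext; simp [Algebra.norm_eq_zero_iff]⟩
  · exact Or.inr (card_norm_eq hKL h0)

theorem card_option_zeroPairs (hKL : Module.finrank K L = 2) :
    Fintype.card (Option (ZeroPairs (fun x : L => Algebra.trace K L x)
      (fun y : L => Algebra.norm K y))) = Fintype.card K ^ 3 + 1 := by
  rw [Fintype.card_option, ← Finset.card_univ,
    Finset.card_eq_sum_card_fiberwise (f := fun p => p.1.2) (t := Finset.univ)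
      (fun _ _ => Finset.mem_coe.2 (Finset.mem_univ _)),
    Finset.sum_const_nat (m := Fintype.card K), Finset.card_univ, card_eq_sq hKL, ← pow_succ]
  intro y _
  rw [← card_trace_eq (L := L) hKL (-Algebra.norm K y)]
  refine Finset.card_bij' (fun p _ => p.1.1)
    (fun x hx => ⟨(x, y), by rw [Finset.mem_filter_univ] at hx; simp [hx]⟩) ?_ ?_ ?_ ?_
  · rintro ⟨⟨x, y'⟩, h⟩ hy
    obtain rfl : y' = y := (Finset.mem_filter.1 hy).2
    rw [Finset.mem_filter_univ]
    exact eq_neg_of_add_eq_zero_left h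
  · intro x hx
    simp
  · rintro ⟨⟨x, y'⟩, h⟩ hy
    obtain rfl : y' = y := (Finset.mem_filter.1 hy).2
    rfl
  · intro x hx
    rfl

open Matrix in
omit [Fintype L] [DecidableEq L] in
theorem crossProduct_genMatrix_ne_zero {A : Type*} [AddMonoid A] (f g : L → A) :
    Pairwise fun p p' => crossProduct ((genMatrix f g)ᵀ p) ((genMatrix f g)ᵀ p') ≠ 0 := by
  intro p p' hp h
  rw [cross_apply] at h
  have h0 := congrFun h 0
  have h1 := congrFun h 1
  have h2 := congrFun h 2
  rcases p with _ | ⟨⟨x, y⟩, hxy⟩ <;> rcases p' with _ | ⟨⟨x', y'⟩, hxy'⟩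
  · exact hp rfl
  · simp [genMatrix] at h2
  · simp [genMatrix] at h2
  · simp [genMatrix] at h1 h2
    apply hp
    obtain rfl : y = y' := by linear_combination h1
    obtain rfl : x = x' := by linear_combination -h2
    rfl

theorem card_zeroSet_genMatrix {A : Type*} [AddMonoid A] [DecidableEq A] (f g : L → A)
    (u : Fin 3 → L) :
    (zeroSet (genMatrix f g) u).card = (if u 1 = 0 then 1 else 0) +
      (Finset.univ.filter fun p : ZeroPairs f g =>
        u 0 + u 1 * p.1.1 + u 2 * p.1.2 = 0).card := by
  rw [zeroSet, Finset.card_filter, Fintype.sum_option, Finset.card_filter]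
  simp [Matrix.vecMul, dotProduct, Fin.sum_univ_three, genMatrix]

theorem card_zeroSet_traceNorm (hKL : Module.finrank K L = 2) {u : Fin 3 → L} (hu : u ≠ 0) :
    (zeroSet (genMatrix (fun x : L => Algebra.trace K L x)
        (fun y : L => Algebra.norm K y)) u).card = 1 ∨
      (zeroSet (genMatrix (fun x : L => Algebra.trace K L x)
        (fun y : L => Algebra.norm K y)) u).card = Fintype.card K + 1 := by
  rw [card_zeroSet_genMatrix]
  by_cases h1 : u 1 = 0
  · by_cases h2 : u 2 = 0
    · have h0 : u 0 ≠ 0 := by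
        intro h0
        refine hu (funext fun i => ?_)
        fin_cases i <;> assumption
      left
      simp [h0, h1, h2]
    · right
      rw [if_pos h1, add_comm, add_left_inj,
        ← card_trace_eq (L := L) hKL (-Algebra.norm K (-(u 0 / u 2)))]
      refine Finset.card_bij' (fun p _ => p.1.1)
        (fun x hx => ⟨(x, -(u 0 / u 2)), by rw [Finset.mem_filter_univ] at hx; simp [hx]⟩)
        ?_ ?_ ?_ ?_
      · rintro ⟨⟨x, y⟩, h⟩ hy
        rw [Finset.mem_filter_univ] at hy ⊢
        obtain rfl : y = -(u 0 / u 2) := by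
          simp only [h1] at hy
          field_simp
          linear_combination hy
        exact eq_neg_of_add_eq_zero_left h
      · intro x hx
        rw [Finset.mem_filter_univ]
        simp only [h1]
        field_simp
        ring
      · rintro ⟨⟨x, y⟩, h⟩ hy
        rw [Finset.mem_filter_univ] at hy
        obtain rfl : y = -(u 0 / u 2) := by
          simp only [h1] at hy
          field_simp
          linear_combination hy
        rfl
      · intro x hx
        rfl
  · rw [if_neg h1, zero_add]
    have hx : ∀ x y : L, u 0 + u 1 * x + u 2 * y = 0 ↔ x = -(u 0 / u 1) + -(u 2 / u 1) * y := by
      intro x y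
      field_simp
      constructor <;> intro h <;> linear_combination h
    have h : (Finset.univ.filter fun p : ZeroPairs (fun x : L => Algebra.trace K L x)
          (fun y : L => Algebra.norm K y) => u 0 + u 1 * p.1.1 + u 2 * p.1.2 = 0).card =
        (Finset.univ.filter fun y : L => Algebra.trace K L (-(u 0 / u 1) + -(u 2 / u 1) * y) +
          Algebra.norm K y = 0).card := by
      refine Finset.card_bij' (fun p _ => p.1.2)
        (fun y hy => ⟨(-(u 0 / u 1) + -(u 2 / u 1) * y, y), by
          rw [Finset.mem_filter_univ] at hy; exact hy⟩)
        ?_ ?_ ?_ ?_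
      · rintro ⟨⟨x, y⟩, h⟩ hy
        rw [Finset.mem_filter_univ, hx] at hy
        rw [Finset.mem_filter_univ, ← hy]
        exact h
      · intro y hy
        rw [Finset.mem_filter_univ, hx]
      · rintro ⟨⟨x, y⟩, h⟩ hy
        rw [Finset.mem_filter_univ, hx] at hy
        exact Subtype.ext (Prod.ext hy.symm rfl)
      · intro y hy
        rfl
    rw [h]
    exact card_trace_add_norm_eq_zero hKL _ _

end TraceNorm

/-! ### The design parameters -/

open Matrix in
theorem hold_designs_of_unital {F ι : Type*} [Field F] [Fintype F] [DecidableEq F] [Fintype ι]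
    [DecidableEq ι] (G : Matrix (Fin 3) ι F) {q : ℕ} (hq : 2 ≤ q) (hF : Fintype.card F = q ^ 2)
    (hι : Fintype.card ι = q ^ 3 + 1)
    (hG : Pairwise fun p p' => crossProduct (Gᵀ p) (Gᵀ p') ≠ 0)
    (hk : ∀ u, u ≠ 0 → (zeroSet G u).card = 1 ∨ (zeroSet G u).card = q + 1) :
    HoldsDesign (Submodule.span F (Set.range G.row))
        2 (q ^ 3 + 1) (q ^ 3 - q) ((q - 1) * (q ^ 3 - q - 1)) ∧
      IsSteinerSystem
        (complementBlocks (blocks (Submodule.span F (Set.range G.row)) (q ^ 3 - q)))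
        2 (q + 1) (q ^ 3 + 1) ∧
      IsMinWeight (dualCode (Submodule.span F (Set.range G.row))) 3 ∧
      ∃ lam : ℕ,
        (lam : ℚ) =
          6 * (numWeight (dualCode (Submodule.span F (Set.range G.row))) 3 : ℚ) /
            ((q : ℚ) ^ 3 * ((q : ℚ) ^ 2 - 1) * ((q : ℚ) ^ 3 + 1)) ∧
        HoldsDesign (dualCode (Submodule.span F (Set.range G.row))) 2 (q ^ 3 + 1) 3 lam := by
  have hq3 : q * 4 ≤ q ^ 3 := by nlinarith
  have hnt : Nontrivial ι := Fintype.one_lt_card_iff_nontrivial.1 (by omega)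
  have hlines := isDesign_lines (k := q + 1) (by omega) (by omega) hG hk
  have hblocks := blocks_eq_complementBlocks G (w := q ^ 3 - q) (k := q + 1) (by omega) (by omega)
  rw [hι] at hlines
  have hr : ∀ p, {B | B ∈ lines G (q + 1) ∧ p ∈ B}.ncard = q ^ 2 := by
    intro p
    refine Nat.eq_of_mul_eq_mul_right (by omega : 0 < q) ?_
    have := hlines.ncard_mem_mul p
    simp only [Nat.add_sub_cancel, one_mul] at this
    rw [this, pow_succ]
  have hb := hlines.ncard_mul hr
  have htri := isDesign_blocks_dualCode_three (by omega) hG hk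
  rw [hι, show q + 1 - 2 = q - 1 by omega] at htri
  set D := dualCode (Submodule.span F (Set.range G.row)) with hD
  have hrtri : ∀ p, {B | B ∈ blocks D 3 ∧ p ∈ B}.ncard * 2 = (q - 1) * q ^ 3 :=
    htri.ncard_mem_mul
  obtain ⟨p₀⟩ : Nonempty ι := inferInstance
  have hbtri := htri.ncard_mul fun p => Nat.eq_of_mul_eq_mul_right two_pos
    ((hrtri p).trans (hrtri p₀).symm)
  have hA := numWeight_dualCode_three hG
  rw [hF, ← hD] at hA
  have hA6 : 6 * numWeight D 3 = (q - 1) * (q ^ 3 * (q ^ 2 - 1) * (q ^ 3 + 1)) := by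
    calc 6 * numWeight D 3 = (blocks D 3).ncard * 3 * 2 * (q ^ 2 - 1) := by rw [hA]; ring
      _ = (q ^ 3 + 1) * ({B | B ∈ blocks D 3 ∧ p₀ ∈ B}.ncard * 2) * (q ^ 2 - 1) := by
        rw [hbtri]; ring
      _ = _ := by rw [hrtri]; ring
  have hq2 : 1 < q ^ 2 := by nlinarith
  have hA0 : numWeight D 3 ≠ 0 := by
    intro h0
    rw [h0, mul_zero, eq_comm] at hA6
    have : 0 < (q - 1) * (q ^ 3 * (q ^ 2 - 1) * (q ^ 3 + 1)) := by
      have h1 : 0 < q - 1 := by omega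
      have h2 : 0 < q ^ 2 - 1 := by omega
      positivity
    omega
  refine ⟨⟨?_, ?_, ?_⟩, ⟨le_rfl, ?_⟩, ⟨?_, ?_⟩, q - 1, ?_, hA0, by omega, htri⟩
  · obtain ⟨p, x, hpx⟩ := exists_pair_ne ι
    obtain ⟨B, ⟨hB, -⟩, -⟩ := existsUnique_line hG hk hpx
    obtain ⟨c, hc, hcw, -⟩ : Bᶜ ∈ blocks (Submodule.span F (Set.range G.row)) (q ^ 3 - q) := by
      rw [hblocks]
      exact ⟨B, hB, rfl⟩
    exact Set.ncard_ne_zero_of_mem (a := c) ⟨hc, hcw⟩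
  · have h1 : 0 < q - 1 := by omega
    have h2 : 0 < q ^ 3 - q - 1 := by omega
    positivity
  · refine ⟨hι, by omega, by omega, by omega, by omega, ?_, fun T hT => ?_⟩
    · rintro B ⟨c, -, hc, rfl⟩
      exact hc
    · rw [hblocks]
      have hc := hlines.ncard_complementBlocks hr T hT
      have hbZ : (q + 1 : ℤ) * (lines G (q + 1)).ncard = (q + 1) * (q ^ 2 * (q ^ 2 - q + 1)) := by
        have : ((lines G (q + 1)).ncard : ℤ) * (q + 1) = (q ^ 3 + 1) * q ^ 2 := by
          exact_mod_cast hb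
        linear_combination this
      have hbZ := mul_left_cancel₀ (by positivity : (q + 1 : ℤ) ≠ 0) hbZ
      zify [show 1 ≤ q by omega, show q ≤ q ^ 3 by omega, show 1 ≤ q ^ 3 - q by omega] at hc ⊢
      linear_combination hc + hbZ
  · rw [hblocks, complementBlocks_complementBlocks]
    exact hlines
  · obtain ⟨c, hc, hc3⟩ := Set.nonempty_of_ncard_ne_zero hA0
    refine ⟨c, hc, ?_, hc3⟩
    rintro rfl
    simp at hc3
  · rintro w ⟨c, hc, hc0, rfl⟩
    exact three_le_hammingNorm hG (mem_dualCode_span_row.1 hc) hc0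
  · have hAQ : (6 * numWeight D 3 : ℚ) = (q - 1) * (q ^ 3 * (q ^ 2 - 1) * (q ^ 3 + 1)) := by
      have := congrArg (Nat.cast (R := ℚ)) hA6
      push_cast [show 1 ≤ q by omega, hq2.le] at this
      exact this
    have hq2' : (q : ℚ) ^ 2 - 1 ≠ 0 := by
      have : (1 : ℚ) < (q : ℚ) ^ 2 := by exact_mod_cast hq2
      linarith
    have hq0 : (q : ℚ) ≠ 0 := by
      have : q ≠ 0 := by omega
      exact_mod_cast this
    rw [hAQ, mul_div_cancel_right₀ _ (by positivity), Nat.cast_sub (by omega), Nat.cast_one]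

end DesignCodes

theorem theorem15 {K L : Type*} [Field K] [Fintype K] [DecidableEq K]
    [Field L] [Fintype L] [DecidableEq L] [Algebra K L]
    (hKL : Module.finrank K L = 2) (q : ℕ) (hq : Fintype.card K = q) :
    DesignCodes.HoldsDesign (DesignCodes.traceNormCode K L)
        2 (q ^ 3 + 1) (q ^ 3 - q) ((q - 1) * (q ^ 3 - q - 1)) ∧
      DesignCodes.IsSteinerSystem
        (DesignCodes.complementBlocks
          (DesignCodes.blocks (DesignCodes.traceNormCode K L) (q ^ 3 - q)))
        2 (q + 1) (q ^ 3 + 1) ∧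
      DesignCodes.IsMinWeight (DesignCodes.dualCode (DesignCodes.traceNormCode K L)) 3 ∧
      ∃ lam : ℕ,
        (lam : ℚ) =
          6 * (DesignCodes.numWeight (DesignCodes.dualCode (DesignCodes.traceNormCode K L)) 3 : ℚ) /
            ((q : ℚ) ^ 3 * ((q : ℚ) ^ 2 - 1) * ((q : ℚ) ^ 3 + 1)) ∧
        DesignCodes.HoldsDesign (DesignCodes.dualCode (DesignCodes.traceNormCode K L))
          2 (q ^ 3 + 1) 3 lam := by
  subst hq
  exact DesignCodes.hold_designs_of_unital _ Fintype.one_lt_card (DesignCodes.card_eq_sq hKL)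
    (DesignCodes.card_option_zeroPairs hKL) (DesignCodes.crossProduct_genMatrix_ne_zero _ _)
    fun _ hu => DesignCodes.card_zeroSet_traceNorm hKL hu
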